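/- Let $\mathcal{C}$ be a bicategory. **Bifactorization systems.** For 1-cells $f:A\to B$ and $g:X\to D$ write $f\perp g$ if the square of hom-categories $$\begin{array}{ccc}\mathcal{C}[B,X]&\to&\mathcal{C}[A,X]\\ \downarrow&&\downarrow\\ \mathcal{C}[B,D]&\to&\mathcal{C}[A,D]\end{array}$$ given by composition with $f$ and $g$ is a bipullback in $\mathbf{Cat}$. A *bifactorization system* $(\mathcal{L},\mathcal{R})$ on $\mathcal{C}$ consists of two classes of 1-cells such that $\mathcal{L}={}^{\perp}\mathcal{R}$, $\mathcal{R}=\mathcal{L}^{\perp}$, and every 1-cell $f$ admits an invertible 2-cell $r_f l_f\simeq f$ with $l_f\in\mathcal{L}$, $r_f\in\mathcal{R}$, where for any other such factorization $r l\simeq f$ there are an equivalence $i$ and invertible 2-cells $i l\simeq l_f$, $r\simeq r_f i$ pasting to the given 2-cells, and these data are unique up to a unique compatible invertible 2-cell. A subclass $\mathcal{L}'\subseteq\mathcal{L}$ has *right cancellation along $\mathcal{L}$-maps* if, for every invertible 2-cell $f l\simeq a$ with $a\in\mathcal{L}'$ and $l\in\mathcal{L}$, one has $f\in\mathcal{L}'$.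 **Bistable pseudofunctors.** Let $U:\mathcal{A}\to\mathcal{B}$ be a pseudofunctor. A 1-cell $n:B\to U(A)$ is *$U$-generic* if: (i) for all $f:B\to U(A_1)$, $u:A_1\to A_2$, $v:A\to A_2$ and every invertible $\alpha:U(u)f\simeq U(v)n$ there are a 1-cell $w:A\to A_1$ and invertible 2-cells $\nu:U(w)n\simeq f$ in $\mathcal{B}$ and $\omega:uw\simeq v$ in $\mathcal{A}$ such that pasting $\nu$ and $U(\omega)$ gives $\alpha$, and such a *filler* $(w,\nu,\omega)$ is unique up to a unique invertible 2-cell compatible with $\nu$ and $\omega$; (ii) for $\alpha_1:U(u)f_1\simeq U(v)n$, $\alpha_2:U(u)f_2\simeq U(v)n$ and any (not necessarily invertible) 2-cell $\phi:f_1\Rightarrow f_2$ with $\alpha_2\cdot(U(u)\phi)=\alpha_1$, and for fillers $(w_i,\nu_i,\omega_i)$ of $\alpha_i$, there is a unique 2-cell $\sigma:w_1\Rightarrow w_2$ with $\omega_2\cdot(u\sigma)=\omega_1$ and $\nu_2\cdot(U(\sigma)n)=\phi\cdot\nu_1$. The pseudofunctor $U$ is *bistable* if every 1-cell $f:B\to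 U(A)$ admits an invertible 2-cell $\alpha_f:U(u_f)n_f\simeq f$ with $n_f:B\to U(A_f)$ generic and $u_f:A_f\to A$ in $\mathcal{A}$, such that for any other $\alpha:U(u)n\simeq f$ with $n:B\to U(A')$ generic there are an equivalence $e:A'\to A_f$ and invertible 2-cells $\nu:U(e)n\simeq n_f$, $\omega:u_f e\simeq u$ whose pasting with $\alpha_f$ is $\alpha$, the data $(e,\nu,\omega)$ being unique up to a unique compatible invertible 2-cell. **Left objects.** For an object $C$, the pseudoslice $\mathcal{C}/C$ has as 0-cells the 1-cells $a:A\to C$, as 1-cells $a\to b$ the pairs $(u,\alpha)$ with $\alpha:bu\simeq a$ invertible, and as 2-cells $(u,\alpha)\Rightarrow(u',\alpha')$ the 2-cells $\phi:u\Rightarrow u'$ with $\alpha=\alpha'\cdot(b\phi)$. Let $\mathcal{L}'\text{-}\mathbf{Obj}_C^{\mathcal{L}_C}$ be the sub-bicategory of $\mathcal{C}/C$ on the 0-cells $a\in\mathcal{L}'$, the 1-cells $(l,\lambda)$ with $l\in\mathcal{L}$, and all 2-cells between them. If $\mathcal{C}$ has a biterminal object $1$ (each $\mathcal{C}[X,1]$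 is equivalent to the terminal category), let $\mathcal{L}'\text{-}\mathbf{Obj}^{\mathcal{L}}$ be the sub-bicategory of $\mathcal{C}$ on the objects whose map to $1$ is in $\mathcal{L}'$, with all $\mathcal{L}$-maps between them and all 2-cells between these. Write $(-)^{\mathrm{op}}$ for the dual reversing 1-cells. **Theorem.** Let $(\mathcal{L},\mathcal{R})$ be a bifactorization system on a bicategory $\mathcal{C}$ and let $\mathcal{L}'\subseteq\mathcal{L}$ have right cancellation along $\mathcal{L}$-maps. Then: 1. if $\mathcal{C}$ has a biterminal object and $\mathcal{L}'$ contains all identities, the inclusion $(\mathcal{L}'\text{-}\mathbf{Obj}^{\mathcal{L}})^{\mathrm{op}}\hookrightarrow\mathcal{C}^{\mathrm{op}}$ is bistable; 2. for each object $C$ of $\mathcal{C}$, the inclusion $(\mathcal{L}'\text{-}\mathbf{Obj}_C^{\mathcal{L}_C})^{\mathrm{op}}\hookrightarrow(\mathcal{C}/C)^{\mathrm{op}}$ is bistable. -/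

import Mathlib

open CategoryTheory Bicategory Opposite

universe w v u w₁ v₁ u₁ w₂ v₂ u₂

namespace BiStab

section Basic

variable {C : Type u} [Bicategory.{w, v} C]

/-- A 1-cell is an equivalence if it has an inverse up to invertible 2-cells. -/
def IsEquiv {X Y : C} (e : X ⟶ Y) : Prop :=
  ∃ e' : Y ⟶ X, Nonempty (e ≫ e' ≅ 𝟙 X) ∧ Nonempty (e' ≫ e ≅ 𝟙 Y)

/-- `T` is biterminal if every hom-category into `T` is equivalent to the terminal category. -/
def IsBiterminal (T : C) : Prop :=
  ∀ X : C, Nonempty ((X ⟶ T) ≌ Discrete PUnit.{1})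

/-! ### Bi-orthogonality -/

/-- The comparison functor from `C[B, X]` to the category of pseudocommutative squares from
`f : A ⟶ B` to `g : X ⟶ D`, i.e. the (pseudo)pullback of `C[A, g]` and `C[f, D]`. It sends `s` to
`(f ≫ s, s ≫ g)` together with the associator. -/
def fillerFunctor {A B X D : C} (f : A ⟶ B) (g : X ⟶ D) :
    (B ⟶ X) ⥤ Limits.CategoricalPullback (postcomp A g) (precomp D f) where
  obj s := { fst := f ≫ s, snd := s ≫ g, iso := α_ f s g }
  map σ := { fst := f ◁ σ, snd := σ ▷ g, w := associator_naturality_middle f σ g }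

/-- `f` is left bi-orthogonal to `g`: the square of hom-categories
`C[B, X] → C[A, X] ×_{C[A, D]} C[B, D]` is a bipullback in `Cat`. -/
def BiOrthogonal {A B X D : C} (f : A ⟶ B) (g : X ⟶ D) : Prop :=
  (fillerFunctor f g).IsEquivalence

theorem BiOrthogonal.exists_filler {A B X D : C} {f : A ⟶ B} {g : X ⟶ D}
    (h : BiOrthogonal f g) (p : A ⟶ X) (q : B ⟶ D) (e : p ≫ g ≅ f ≫ q) :
    ∃ (s : B ⟶ X) (l : f ≫ s ≅ p) (r : s ≫ g ≅ q),
      l.hom ▷ g ≫ e.hom = (α_ f s g).hom ≫ f ◁ r.hom := by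
  have : (fillerFunctor f g).IsEquivalence := h
  let S : Limits.CategoricalPullback (postcomp A g) (precomp D f) := ⟨p, q, e⟩
  let i := (fillerFunctor f g).objObjPreimageIso S
  refine ⟨(fillerFunctor f g).objPreimage S,
    (Limits.CategoricalPullback.π₁ _ _).mapIso i,
    (Limits.CategoricalPullback.π₂ _ _).mapIso i, i.hom.w⟩

theorem BiOrthogonal.exists_cell {A B X D : C} {f : A ⟶ B} {g : X ⟶ D}
    (h : BiOrthogonal f g) {s t : B ⟶ X} (φ : f ≫ s ⟶ f ≫ t) (ψ : s ≫ g ⟶ t ≫ g)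
    (e : φ ▷ g ≫ (α_ f t g).hom = (α_ f s g).hom ≫ f ◁ ψ) :
    ∃ σ : s ⟶ t, f ◁ σ = φ ∧ σ ▷ g = ψ := by
  have : (fillerFunctor f g).IsEquivalence := h
  let m : (fillerFunctor f g).obj s ⟶ (fillerFunctor f g).obj t := ⟨φ, ψ, e⟩
  refine ⟨(fillerFunctor f g).preimage m, ?_, ?_⟩
  · exact congrArg Limits.CategoricalPullback.Hom.fst ((fillerFunctor f g).map_preimage m)
  · exact congrArg Limits.CategoricalPullback.Hom.snd ((fillerFunctor f g).map_preimage m)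

theorem BiOrthogonal.cell_ext {A B X D : C} {f : A ⟶ B} {g : X ⟶ D}
    (h : BiOrthogonal f g) {s t : B ⟶ X} {σ τ : s ⟶ t} (h₁ : f ◁ σ = f ◁ τ)
    (h₂ : σ ▷ g = τ ▷ g) : σ = τ := by
  have : (fillerFunctor f g).IsEquivalence := h
  exact (fillerFunctor f g).map_injective (Limits.CategoricalPullback.Hom.ext h₁ h₂)

theorem BiOrthogonal.mk {A B X D : C} {f : A ⟶ B} {g : X ⟶ D}
    (h₁ : ∀ (p : A ⟶ X) (q : B ⟶ D) (e : p ≫ g ≅ f ≫ q),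
      ∃ (s : B ⟶ X) (l : f ≫ s ≅ p) (r : s ≫ g ≅ q),
        l.hom ▷ g ≫ e.hom = (α_ f s g).hom ≫ f ◁ r.hom)
    (h₂ : ∀ (s t : B ⟶ X) (φ : f ≫ s ⟶ f ≫ t) (ψ : s ≫ g ⟶ t ≫ g),
      φ ▷ g ≫ (α_ f t g).hom = (α_ f s g).hom ≫ f ◁ ψ →
        ∃ σ : s ⟶ t, f ◁ σ = φ ∧ σ ▷ g = ψ)
    (h₃ : ∀ (s t : B ⟶ X) (σ τ : s ⟶ t), f ◁ σ = f ◁ τ → σ ▷ g = τ ▷ g → σ = τ) :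
    BiOrthogonal f g where
  faithful := ⟨fun {s t σ τ} h => h₃ s t σ τ
    (congrArg Limits.CategoricalPullback.Hom.fst h)
    (congrArg Limits.CategoricalPullback.Hom.snd h)⟩
  full := ⟨fun {s t} m => by
    obtain ⟨σ, hσ₁, hσ₂⟩ := h₂ s t m.fst m.snd m.w
    exact ⟨σ, Limits.CategoricalPullback.Hom.ext hσ₁ hσ₂⟩⟩
  essSurj := ⟨fun S => by
    obtain ⟨s, l, r, h⟩ := h₁ S.fst S.snd S.iso
    exact ⟨s, ⟨Limits.CategoricalPullback.mkIso l r h⟩⟩⟩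

theorem BiOrthogonal.id_left (A : C) {X D : C} (g : X ⟶ D) : BiOrthogonal (𝟙 A) g := by
  refine BiOrthogonal.mk ?_ ?_ ?_
  · intro p q e
    exact ⟨p, λ_ p, e ≪≫ λ_ q, by simp⟩
  · intro s t φ ψ e
    have key : 𝟙 A ◁ ((λ_ s).inv ≫ φ ≫ (λ_ t).hom) = φ := by simp
    refine ⟨(λ_ s).inv ≫ φ ≫ (λ_ t).hom, key, ?_⟩
    have h : 𝟙 A ◁ (((λ_ s).inv ≫ φ ≫ (λ_ t).hom) ▷ g) = 𝟙 A ◁ ψ := by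
      rw [← cancel_epi (α_ (𝟙 A) s g).hom, ← e, ← associator_naturality_middle, key]
    simpa only [id_whiskerLeft, cancel_epi, cancel_mono] using h
  · intro s t σ τ h _
    simpa only [id_whiskerLeft, cancel_epi, cancel_mono] using h

theorem BiOrthogonal.comp_left {A A' B X D : C} {f₁ : A ⟶ A'} {f₂ : A' ⟶ B} {g : X ⟶ D}
    (h₁ : BiOrthogonal f₁ g) (h₂ : BiOrthogonal f₂ g) : BiOrthogonal (f₁ ≫ f₂) g := by
  refine BiOrthogonal.mk ?_ ?_ ?_
  · intro p q e
    obtain ⟨s₁, l₁, r₁, e₁⟩ := h₁.exists_filler p (f₂ ≫ q) (e ≪≫ α_ f₁ f₂ q)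
    obtain ⟨s, l, r, e₂⟩ := h₂.exists_filler s₁ q r₁
    refine ⟨s, α_ f₁ f₂ s ≪≫ whiskerLeftIso f₁ l ≪≫ l₁, r, ?_⟩
    have e₁' : l₁.hom ▷ g ≫ e.hom = (α_ f₁ s₁ g).hom ≫ f₁ ◁ r₁.hom ≫ (α_ f₁ f₂ q).inv := by
      rw [← cancel_mono (α_ f₁ f₂ q).hom]
      simpa using e₁
    simp only [Iso.trans_hom, whiskerLeftIso_hom, comp_whiskerRight, Category.assoc]
    rw [e₁', associator_naturality_middle_assoc, ← whiskerLeft_comp_assoc, e₂]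
    simp
  · intro s t φ ψ e
    obtain ⟨σ₁, a, b⟩ := h₁.exists_cell (s := f₂ ≫ s) (t := f₂ ≫ t)
      ((α_ f₁ f₂ s).inv ≫ φ ≫ (α_ f₁ f₂ t).hom)
      ((α_ f₂ s g).hom ≫ f₂ ◁ ψ ≫ (α_ f₂ t g).inv) (by
        have e' : φ ▷ g = (α_ (f₁ ≫ f₂) s g).hom ≫ (f₁ ≫ f₂) ◁ ψ ≫ (α_ (f₁ ≫ f₂) t g).inv := by
          rw [← cancel_mono (α_ (f₁ ≫ f₂) t g).hom]
          simpa using e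
        simp [e'])
    obtain ⟨σ, c, d⟩ := h₂.exists_cell σ₁ ψ (by rw [b]; simp)
    exact ⟨σ, by rw [comp_whiskerLeft, c, a]; simp, d⟩
  · intro s t σ τ a b
    refine h₂.cell_ext (h₁.cell_ext ?_ ?_) b
    · simpa only [comp_whiskerLeft, cancel_epi, cancel_mono] using a
    · simp [b]

/-! ### Bifactorization systems -/

/-- An equivalence between two factorizations `r' ∘ l' ≃ f` (via `β`) and `r ∘ l ≃ f` (via `α`):
an equivalence `i` between the middle objects, with invertible 2-cells `lam : i ∘ l' ≃ l` and
`rho : r' ≃ r ∘ i` whose pasting with `α` is `β`. -/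
structure FactEquiv {A B X X' : C} {f : A ⟶ B} {l : A ⟶ X} {r : X ⟶ B} (α : l ≫ r ≅ f)
    {l' : A ⟶ X'} {r' : X' ⟶ B} (β : l' ≫ r' ≅ f) where
  i : X' ⟶ X
  isEquiv : IsEquiv i
  lam : l' ≫ i ≅ l
  rho : r' ≅ i ≫ r
  w : β.hom = l' ◁ rho.hom ≫ (α_ l' i r).inv ≫ lam.hom ▷ r ≫ α.hom

/-- `(L, R)` is a bifactorization system: each class is the bi-orthogonal of the other, and every
1-cell has an `(L, R)`-factorization up to an invertible 2-cell, unique up to an equivalence which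
is itself unique up to a unique invertible 2-cell. -/
structure IsBifactorizationSystem (L R : MorphismProperty C) : Prop where
  left_iff : ∀ {A B : C} (f : A ⟶ B),
    L f ↔ ∀ ⦃X D : C⦄ (g : X ⟶ D), R g → BiOrthogonal f g
  right_iff : ∀ {X D : C} (g : X ⟶ D),
    R g ↔ ∀ ⦃A B : C⦄ (f : A ⟶ B), L f → BiOrthogonal f g
  factorization : ∀ {A B : C} (f : A ⟶ B),
    ∃ (X : C) (l : A ⟶ X) (r : X ⟶ B) (α : l ≫ r ≅ f), L l ∧ R r ∧
      ∀ (X' : C) (l' : A ⟶ X') (r' : X' ⟶ B) (β : l' ≫ r' ≅ f), L l' → R r' →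
        Nonempty (FactEquiv α β) ∧
        ∀ c d : FactEquiv α β, ∃! σ : c.i ≅ d.i,
          l' ◁ σ.hom ≫ d.lam.hom = c.lam.hom ∧ c.rho.hom ≫ σ.hom ▷ r = d.rho.hom

theorem IsBifactorizationSystem.id_mem {L R : MorphismProperty C}
    (h : IsBifactorizationSystem L R) (X : C) : L (𝟙 X) :=
  (h.left_iff _).2 fun _ _ g _ => BiOrthogonal.id_left X g

theorem IsBifactorizationSystem.comp_mem {L R : MorphismProperty C}
    (h : IsBifactorizationSystem L R) {X Y Z : C} (f : X ⟶ Y) (g : Y ⟶ Z) (hf : L f)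
    (hg : L g) : L (f ≫ g) :=
  (h.left_iff _).2 fun _ _ k hk =>
    BiOrthogonal.comp_left ((h.left_iff f).1 hf k hk) ((h.left_iff g).1 hg k hk)

/-- `L'` has right cancellation along `L`-maps: if `f ∘ l ≃ a` with `a` in `L'` and `l` in `L`,
then `f` is in `L'`. -/
def HasRightCancellationAlong (L' L : MorphismProperty C) : Prop :=
  ∀ ⦃A B X : C⦄ (l : A ⟶ B) (f : B ⟶ X) (a : A ⟶ X),
    Nonempty (l ≫ f ≅ a) → L' a → L l → L' f

end Basic

/-! ### Locally full sub-bicategories -/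

/-- A class of 0-cells and a class of 1-cells, the latter containing identities and closed under
composition. It determines a sub-bicategory with all 2-cells between the selected 1-cells. -/
structure SubData (C : Type u) [Bicategory.{w, v} C] where
  objProp : C → Prop
  homProp : MorphismProperty C
  id_mem : ∀ X : C, homProp (𝟙 X)
  comp_mem : ∀ {X Y Z : C} (f : X ⟶ Y) (g : Y ⟶ Z), homProp f → homProp g → homProp (f ≫ g)

section Sub

variable {C : Type u} [Bicategory.{w, v} C]

/-- The 0-cells of the sub-bicategory. -/
structure Sub (S : SubData C) where
  obj : C
  property : S.objProp obj

namespace Sub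

variable {S : SubData C}

/-- The 1-cells of the sub-bicategory. -/
structure Hom (X Y : Sub S) where
  hom : X.obj ⟶ Y.obj
  property : S.homProp hom

@[simps]
instance : CategoryStruct (Sub S) where
  Hom X Y := Hom X Y
  id X := ⟨𝟙 X.obj, S.id_mem _⟩
  comp f g := ⟨f.hom ≫ g.hom, S.comp_mem _ _ f.property g.property⟩

/-- The 2-cells of the sub-bicategory. -/
@[ext]
structure Hom₂ {X Y : Sub S} (f g : X ⟶ Y) where
  cell : Hom.hom f ⟶ Hom.hom g

@[simps]
instance homCategory (X Y : Sub S) : Category (X ⟶ Y) where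
  Hom f g := Hom₂ f g
  id f := ⟨𝟙 (Hom.hom f)⟩
  comp η θ := ⟨η.cell ≫ θ.cell⟩

@[ext]
theorem hom₂_ext {X Y : Sub S} {f g : X ⟶ Y} {η θ : f ⟶ g} (h : η.cell = θ.cell) : η = θ :=
  Hom₂.ext h

/-- An invertible 2-cell between selected 1-cells is invertible in the sub-bicategory. -/
@[simps]
def isoMk {X Y : Sub S} {f g : X ⟶ Y} (e : Hom.hom f ≅ Hom.hom g) : f ≅ g where
  hom := ⟨e.hom⟩
  inv := ⟨e.inv⟩

instance bicategory : Bicategory (Sub S) where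
  homCategory := homCategory
  whiskerLeft f _ _ η := ⟨Hom.hom f ◁ η.cell⟩
  whiskerRight η h := ⟨η.cell ▷ Hom.hom h⟩
  associator f g h := isoMk (α_ (Hom.hom f) (Hom.hom g) (Hom.hom h))
  leftUnitor f := isoMk (λ_ (Hom.hom f))
  rightUnitor f := isoMk (ρ_ (Hom.hom f))
  whisker_exchange η θ := Hom₂.ext (whisker_exchange η.cell θ.cell)

variable (S)

/-- The inclusion of the sub-bicategory. -/
def incl : Pseudofunctor (Sub S) C where
  obj X := X.obj
  map f := Hom.hom f
  map₂ η := η.cell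
  mapId X := Iso.refl _
  mapComp f g := Iso.refl _

end Sub

end Sub

/-! ### Pseudoslices -/

section Slice

variable {C : Type u} [Bicategory.{w, v} C]

/-- The 0-cells of the pseudoslice over `X`: 1-cells with codomain `X`. -/
structure PseudoSlice (X : C) where
  dom : C
  str : dom ⟶ X

namespace PseudoSlice

variable {X : C}

/-- The 1-cells of the pseudoslice: triangles filled by an invertible 2-cell. -/
structure Hom (a b : PseudoSlice X) where
  hom : a.dom ⟶ b.dom
  iso : hom ≫ b.str ≅ a.str

@[simps]
instance : CategoryStruct (PseudoSlice X) where
  Hom a b := Hom a b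
  id a := ⟨𝟙 a.dom, λ_ a.str⟩
  comp {_ _ c} f g :=
    ⟨f.hom ≫ g.hom, α_ f.hom g.hom c.str ≪≫ whiskerLeftIso f.hom g.iso ≪≫ f.iso⟩

/-- The 2-cells of the pseudoslice: 2-cells compatible with the triangles. -/
@[ext]
structure Hom₂ {a b : PseudoSlice X} (f g : a ⟶ b) where
  cell : Hom.hom f ⟶ Hom.hom g
  w : cell ▷ b.str ≫ (Hom.iso g).hom = (Hom.iso f).hom

@[simps]
instance homCategory (a b : PseudoSlice X) : Category (a ⟶ b) where
  Hom f g := Hom₂ f g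
  id f := ⟨𝟙 (Hom.hom f), by simp⟩
  comp η θ := ⟨η.cell ≫ θ.cell, by rw [comp_whiskerRight, Category.assoc, θ.w, η.w]⟩

@[ext]
theorem hom₂_ext {a b : PseudoSlice X} {f g : a ⟶ b} {η θ : f ⟶ g} (h : η.cell = θ.cell) :
    η = θ :=
  Hom₂.ext h

/-- An invertible 2-cell compatible with the triangles is invertible in the pseudoslice. -/
@[simps]
def isoMk {a b : PseudoSlice X} {f g : a ⟶ b} (e : Hom.hom f ≅ Hom.hom g)
    (w : e.hom ▷ b.str ≫ (Hom.iso g).hom = (Hom.iso f).hom) : f ≅ g where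
  hom := ⟨e.hom, w⟩
  inv := ⟨e.inv, by rw [← w]; simp⟩

instance bicategory : Bicategory (PseudoSlice X) where
  homCategory := homCategory
  whiskerLeft {_ _ c} f g h η := ⟨Hom.hom f ◁ η.cell, by
    simp [← η.w]⟩
  whiskerRight {_ _ c f g} η h := ⟨η.cell ▷ Hom.hom h, by
    simp [← η.w, whisker_exchange_assoc]⟩
  associator f g h := isoMk (α_ (Hom.hom f) (Hom.hom g) (Hom.hom h)) (by simp)
  leftUnitor f := isoMk (λ_ (Hom.hom f)) (by simp)
  rightUnitor f := isoMk (ρ_ (Hom.hom f)) (by simp)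
  whisker_exchange η θ := Hom₂.ext (whisker_exchange η.cell θ.cell)

end PseudoSlice

end Slice

/-! ### Opposite pseudofunctor -/

section Op

variable {A : Type u₁} [Bicategory.{w₁, v₁} A] {B : Type u₂} [Bicategory.{w₂, v₂} B]

/-- The pseudofunctor between 1-cell duals induced by a pseudofunctor. -/
def opPseudofunctor (F : Pseudofunctor A B) : Pseudofunctor Aᵒᵖ Bᵒᵖ where
  obj X := op (F.obj X.unop)
  map f := (F.map f.unop).op
  map₂ η := Opposite.op2 (F.map₂ η.unop2)
  map₂_id f := congrArg Opposite.op2 (F.map₂_id f.unop)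
  map₂_comp η θ := congrArg Opposite.op2 (F.map₂_comp η.unop2 θ.unop2)
  mapId X := (F.mapId X.unop).op2
  mapComp f g := (F.mapComp g.unop f.unop).op2
  map₂_whisker_left f _ _ η := congrArg Opposite.op2 (F.map₂_whisker_right η.unop2 f.unop)
  map₂_whisker_right η h := congrArg Opposite.op2 (F.map₂_whisker_left h.unop η.unop2)
  map₂_associator f g h := congrArg Opposite.op2 (by
    change F.map₂ (α_ h.unop g.unop f.unop).inv = (F.mapComp h.unop (g.unop ≫ f.unop)).hom ≫
      F.map h.unop ◁ (F.mapComp g.unop f.unop).hom ≫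
        (α_ (F.map h.unop) (F.map g.unop) (F.map f.unop)).inv ≫
          (F.mapComp h.unop g.unop).inv ▷ F.map f.unop ≫ (F.mapComp (h.unop ≫ g.unop) f.unop).inv
    rw [← F.map₂Iso_inv, ← cancel_epi (F.map₂Iso (α_ h.unop g.unop f.unop)).hom,
      Iso.hom_inv_id]
    simp)
  map₂_left_unitor f := congrArg Opposite.op2 (F.map₂_right_unitor f.unop)
  map₂_right_unitor f := congrArg Opposite.op2 (F.map₂_left_unitor f.unop)

end Op

/-! ### Generic 1-cells and bistable pseudofunctors -/

section Bistable

variable {A : Type u₁} [Bicategory.{w₁, v₁} A] {B : Type u₂} [Bicategory.{w₂, v₂} B]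
variable (U : Pseudofunctor A B)

/-- A filler of the pseudosquare `α : U(u) ∘ f ≃ U(v) ∘ n`: a 1-cell `w` of `A` with invertible
2-cells `ν : U(w) ∘ n ≃ f` in `B` and `ω : u ∘ w ≃ v` in `A`, whose pasting is `α`. -/
structure Filler {b : B} {a a₁ a₂ : A} (n : b ⟶ U.obj a) {f : b ⟶ U.obj a₁} {u : a₁ ⟶ a₂}
    {v : a ⟶ a₂} (α : f ≫ U.map u ≅ n ≫ U.map v) where
  w : a ⟶ a₁
  ν : n ≫ U.map w ≅ f
  ω : w ≫ u ≅ v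
  paste : ν.hom ▷ U.map u ≫ α.hom =
    (α_ n (U.map w) (U.map u)).hom ≫ n ◁ ((U.mapComp w u).inv ≫ U.map₂ ω.hom)

/-- `n : b ⟶ U(a)` is `U`-generic: every pseudosquare from `n` to some `U(u)` has a filler, unique
up to a unique invertible 2-cell, and every morphism of pseudosquares `φ : f₁ ⟶ f₂` with fixed
bottom side `U(v)` induces a unique compatible 2-cell between the corresponding fillers. -/
structure IsGeneric {b : B} {a : A} (n : b ⟶ U.obj a) : Prop where
  exists_filler : ∀ {a₁ a₂ : A} (f : b ⟶ U.obj a₁) (u : a₁ ⟶ a₂) (v : a ⟶ a₂)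
    (α : f ≫ U.map u ≅ n ≫ U.map v), Nonempty (Filler U n α)
  filler_unique : ∀ {a₁ a₂ : A} (f : b ⟶ U.obj a₁) (u : a₁ ⟶ a₂) (v : a ⟶ a₂)
    (α : f ≫ U.map u ≅ n ≫ U.map v) (s t : Filler U n α),
    ∃! σ : s.w ≅ t.w, σ.hom ▷ u ≫ t.ω.hom = s.ω.hom ∧ n ◁ U.map₂ σ.hom ≫ t.ν.hom = s.ν.hom
  exists_unique_cell : ∀ {a₁ a₂ : A} (f₁ f₂ : b ⟶ U.obj a₁) (u : a₁ ⟶ a₂) (v : a ⟶ a₂)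
    (α₁ : f₁ ≫ U.map u ≅ n ≫ U.map v) (α₂ : f₂ ≫ U.map u ≅ n ≫ U.map v) (φ : f₁ ⟶ f₂),
    φ ▷ U.map u ≫ α₂.hom = α₁.hom →
    ∀ (s : Filler U n α₁) (t : Filler U n α₂),
      ∃! σ : s.w ⟶ t.w, σ ▷ u ≫ t.ω.hom = s.ω.hom ∧
        n ◁ U.map₂ σ ≫ t.ν.hom = s.ν.hom ≫ φ

/-- An equivalence between two factorizations of `f : b ⟶ U(a)`, namely `β : U(u') ∘ n' ≃ f` and
`α : U(u) ∘ n ≃ f`: an equivalence `e` of `A` between the middle objects, with invertible 2-cells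
`ν : U(e) ∘ n' ≃ n` in `B` and `ω : u ∘ e ≃ u'` in `A`, whose pasting with `α` is `β`. -/
structure GenericFactEquiv {b : B} {a m m' : A} {f : b ⟶ U.obj a} {n : b ⟶ U.obj m} {u : m ⟶ a}
    (α : n ≫ U.map u ≅ f) {n' : b ⟶ U.obj m'} {u' : m' ⟶ a} (β : n' ≫ U.map u' ≅ f) where
  e : m' ⟶ m
  isEquiv : IsEquiv e
  ν : n' ≫ U.map e ≅ n
  ω : e ≫ u ≅ u'
  paste : n' ◁ U.map₂ ω.hom ≫ β.hom = n' ◁ (U.mapComp e u).hom ≫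
    (α_ n' (U.map e) (U.map u)).inv ≫ ν.hom ▷ U.map u ≫ α.hom

/-- `U` is bistable: every `f : b ⟶ U(a)` factors, up to an invertible 2-cell, as a generic 1-cell
followed by a 1-cell in the range of `U`, and such a factorization is unique up to an equivalence
which is itself unique up to a unique invertible 2-cell. -/
def IsBistable : Prop :=
  ∀ {b : B} {a : A} (f : b ⟶ U.obj a),
    ∃ (m : A) (n : b ⟶ U.obj m) (u : m ⟶ a) (α : n ≫ U.map u ≅ f), IsGeneric U n ∧
      ∀ (m' : A) (n' : b ⟶ U.obj m') (u' : m' ⟶ a) (β : n' ≫ U.map u' ≅ f), IsGeneric U n' →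
        Nonempty (GenericFactEquiv U α β) ∧
        ∀ c d : GenericFactEquiv U α β, ∃! σ : c.e ≅ d.e,
          σ.hom ▷ u ≫ d.ω.hom = c.ω.hom ∧ n' ◁ U.map₂ σ.hom ≫ d.ν.hom = c.ν.hom

end Bistable

/-! ### The bicategories of specified left objects -/

section LeftObjects

variable {C : Type u} [Bicategory.{w, v} C] {L R : MorphismProperty C}

/-- The sub-bicategory of `C` of `L'`-objects, i.e. objects whose map to the biterminal object `T`
is in `L'`, with all `L`-maps between them and all 2-cells between these. -/
def leftObj (h : IsBifactorizationSystem L R) (L' : MorphismProperty C) (T : C) : SubData C where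
  objProp X := ∃ t : X ⟶ T, L' t
  homProp := L
  id_mem := h.id_mem
  comp_mem := h.comp_mem

/-- The sub-bicategory of the pseudoslice over `X` whose 0-cells are the `L'`-maps into `X`, with
all triangles whose top side is an `L`-map and all 2-cells between these. -/
def leftObjOver (h : IsBifactorizationSystem L R) (L' : MorphismProperty C) (X : C) :
    SubData (PseudoSlice X) where
  objProp a := L' a.str
  homProp _ _ f := L f.hom
  id_mem a := h.id_mem a.dom
  comp_mem f g hf hg := h.comp_mem f.hom g.hom hf hg

end LeftObjects

end BiStab

/-!
Let `(L, R)` be a bifactorization system. In `Cᵒᵖ`, the pseudosquares to be filled in the definition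
of a generic 1-cell `n` are those of `C` with an `L`-map on the left and `n` on the right, so
bi-orthogonality fills them when `n` is an `R`-map, and the diagonal is again an `L`-map because `L`
is right cancellative. Hence an `(L, R)`-factorization of `f : a ⟶ b` becomes a generic
factorization of `f.op` as soon as the middle object belongs to the sub-bicategory, which is what
right cancellation of `L'` along `L` provides. The case of a pseudoslice is the same statement,
since factorizations and bi-orthogonality lift along the projection `C/X ⟶ C`.
-/

namespace BiStab

section Orthogonality

variable {C : Type u} [Bicategory.{w, v} C] {A B X D : C}

theorem BiOrthogonal.exists_iso {f : A ⟶ B} {g : X ⟶ D} (h : BiOrthogonal f g) {s t : B ⟶ X}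
    (φ : f ≫ s ≅ f ≫ t) (ψ : s ≫ g ≅ t ≫ g)
    (e : φ.hom ▷ g ≫ (α_ f t g).hom = (α_ f s g).hom ≫ f ◁ ψ.hom) :
    ∃ σ : s ≅ t, f ◁ σ.hom = φ.hom ∧ σ.hom ▷ g = ψ.hom := by
  have : (fillerFunctor f g).IsEquivalence := h
  let m : (fillerFunctor f g).obj s ≅ (fillerFunctor f g).obj t :=
    Limits.CategoricalPullback.mkIso φ ψ e
  have hm : (fillerFunctor f g).map ((fillerFunctor f g).preimageIso m).hom = m.hom :=
    (fillerFunctor f g).map_preimage m.hom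
  exact ⟨(fillerFunctor f g).preimageIso m,
    congrArg Limits.CategoricalPullback.Hom.fst hm, congrArg Limits.CategoricalPullback.Hom.snd hm⟩

theorem BiOrthogonal.of_iso_left {f f' : A ⟶ B} {g : X ⟶ D} (h : BiOrthogonal f g)
    (i : f ≅ f') : BiOrthogonal f' g := by
  refine BiOrthogonal.mk ?_ ?_ ?_
  · intro p q e
    obtain ⟨s, l, r, w⟩ := h.exists_filler p q (e ≪≫ whiskerRightIso i.symm q)
    have w' : l.hom ▷ g ≫ e.hom = (α_ f s g).hom ≫ f ◁ r.hom ≫ i.hom ▷ q := by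
      rw [← cancel_mono (i.inv ▷ q)]
      simpa using w
    exact ⟨s, whiskerRightIso i.symm s ≪≫ l, r, by simp [w', whisker_exchange]⟩
  · intro s t φ ψ e
    have hφ : φ ▷ g = (α_ f' s g).hom ≫ f' ◁ ψ ≫ (α_ f' t g).inv := by
      rw [← cancel_mono (α_ f' t g).hom]
      simpa using e
    have e' : (i.hom ▷ s ≫ φ ≫ i.inv ▷ t) ▷ g ≫ (α_ f t g).hom = (α_ f s g).hom ≫ f ◁ ψ := by
      simp only [comp_whiskerRight, hφ, Category.assoc]
      rw [associator_naturality_left_assoc, ← whisker_exchange_assoc]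
      simp
    obtain ⟨σ, hσ, hσ'⟩ := h.exists_cell _ ψ e'
    refine ⟨σ, ?_, hσ'⟩
    rw [← cancel_epi (i.hom ▷ s), ← whisker_exchange, hσ]
    simp
  · intro s t σ τ hl hr
    refine h.cell_ext ?_ hr
    rw [← cancel_mono (i.hom ▷ t), whisker_exchange, whisker_exchange, hl]

theorem BiOrthogonal.of_comp_left {E : C} {u : A ⟶ B} {f : B ⟶ E} {g : X ⟶ D}
    (hu : BiOrthogonal u g) (huf : BiOrthogonal (u ≫ f) g) : BiOrthogonal f g := by
  refine BiOrthogonal.mk ?_ ?_ ?_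
  · intro p q e
    obtain ⟨s, l, r, w⟩ := huf.exists_filler (u ≫ p) q
      (α_ u p g ≪≫ whiskerLeftIso u e ≪≫ (α_ u f q).symm)
    have w' : l.hom ▷ g ≫ (α_ u p g).hom ≫ u ◁ e.hom =
        (α_ (u ≫ f) s g).hom ≫ (u ≫ f) ◁ r.hom ≫ (α_ u f q).hom := by
      rw [← cancel_mono (α_ u f q).inv]
      simpa using w
    -- `f ≫ s` and `p` both fill the square from `u` to `g` with bottom side `f ≫ q`.
    obtain ⟨σ, -, hσ⟩ := hu.exists_iso ((α_ u f s).symm ≪≫ l)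
      (α_ f s g ≪≫ whiskerLeftIso f r ≪≫ e.symm) (by
        rw [← cancel_mono (u ◁ e.hom)]
        simp [w'])
    exact ⟨s, σ, r, by simp [hσ]⟩
  · intro s t φ ψ e
    have hφ : φ ▷ g = (α_ f s g).hom ≫ f ◁ ψ ≫ (α_ f t g).inv := by
      rw [← cancel_mono (α_ f t g).hom]
      simpa using e
    obtain ⟨σ, hσ, hσ'⟩ := huf.exists_cell ((α_ u f s).hom ≫ u ◁ φ ≫ (α_ u f t).inv) ψ (by
      simp [hφ])
    refine ⟨σ, hu.cell_ext ?_ ?_, hσ'⟩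
    · simpa only [comp_whiskerLeft, cancel_epi, cancel_mono] using hσ
    · rw [hφ, ← hσ', whisker_assoc]
  · intro s t σ τ hl hr
    exact huf.cell_ext (by simp only [comp_whiskerLeft, hl]) hr

/-- A diagonal filling the pseudosquare `α` from `f` to `g`. The 2-cell `α` points from `f ≫ q` to
`p ≫ g`, so that in `Cᵒᵖ` it has the orientation used in `Filler`. -/
structure Lift {f : A ⟶ B} {g : X ⟶ D} {p : A ⟶ X} {q : B ⟶ D} (α : f ≫ q ≅ p ≫ g) where
  diag : B ⟶ X
  left : f ≫ diag ≅ p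
  right : diag ≫ g ≅ q
  w : f ◁ right.hom ≫ α.hom = (α_ f diag g).inv ≫ left.hom ▷ g

theorem BiOrthogonal.nonempty_lift {f : A ⟶ B} {g : X ⟶ D} (h : BiOrthogonal f g) {p : A ⟶ X}
    {q : B ⟶ D} (α : f ≫ q ≅ p ≫ g) : Nonempty (Lift α) := by
  obtain ⟨s, l, r, w⟩ := h.exists_filler p q α.symm
  refine ⟨⟨s, l, r, ?_⟩⟩
  rw [Iso.eq_inv_comp, ← reassoc_of% w]
  simp

theorem BiOrthogonal.existsUnique_lift_cell {f : A ⟶ B} {g : X ⟶ D} (h : BiOrthogonal f g)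
    {p : A ⟶ X} {q₁ q₂ : B ⟶ D} {α₁ : f ≫ q₁ ≅ p ≫ g} {α₂ : f ≫ q₂ ≅ p ≫ g} {φ : q₁ ⟶ q₂}
    (hφ : f ◁ φ ≫ α₂.hom = α₁.hom) (s : Lift α₁) (t : Lift α₂) :
    ∃! σ : s.diag ⟶ t.diag,
      f ◁ σ ≫ t.left.hom = s.left.hom ∧ σ ▷ g ≫ t.right.hom = s.right.hom ≫ φ := by
  obtain ⟨σ, hσ, hσ'⟩ := h.exists_cell (s.left.hom ≫ t.left.inv)
    (s.right.hom ≫ φ ≫ t.right.inv) (by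
      rw [← cancel_mono (f ◁ t.right.hom), ← cancel_mono α₂.hom]
      simp [hφ, s.w, t.w])
  refine ⟨σ, ⟨by simp [hσ], by simp [hσ']⟩, fun τ ⟨hτ, hτ'⟩ => h.cell_ext ?_ ?_⟩
  · rw [hσ, ← hτ, Category.assoc, Iso.hom_inv_id, Category.comp_id]
  · rw [hσ', ← reassoc_of% hτ', Iso.hom_inv_id, Category.comp_id]

/-- The classes `L` and `R` are bi-orthogonal, `L` is right cancellative, and every 1-cell has an
`(L, R)`-factorization. A bifactorization system has these properties, and unlike its definition
they pass to pseudoslices at once. -/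
structure HasOrthogonalFactorizations (L R : MorphismProperty C) : Prop where
  biOrthogonal : ∀ {A B X D : C} {f : A ⟶ B} {g : X ⟶ D}, L f → R g → BiOrthogonal f g
  cancel : HasRightCancellationAlong L L
  factorization : ∀ {A B : C} (f : A ⟶ B),
    ∃ (M : C) (l : A ⟶ M) (r : M ⟶ B), L l ∧ R r ∧ Nonempty (l ≫ r ≅ f)

variable {L R : MorphismProperty C}

theorem IsBifactorizationSystem.hasRightCancellationAlong_left
    (h : IsBifactorizationSystem L R) : HasRightCancellationAlong L L := by
  rintro X Y Z u f v ⟨i⟩ hv hu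
  refine (h.left_iff f).2 fun _ _ g hg => ?_
  exact ((h.left_iff u).1 hu g hg).of_comp_left (((h.left_iff v).1 hv g hg).of_iso_left i.symm)

theorem IsBifactorizationSystem.hasOrthogonalFactorizations
    (h : IsBifactorizationSystem L R) : HasOrthogonalFactorizations L R where
  biOrthogonal hf hg := (h.left_iff _).1 hf _ hg
  cancel := h.hasRightCancellationAlong_left
  factorization f := by
    obtain ⟨M, l, r, α, hl, hr, -⟩ := h.factorization f
    exact ⟨M, l, r, hl, hr, ⟨α⟩⟩

end Orthogonality

section Generic

variable {A : Type u₁} [Bicategory.{w₁, v₁} A] {B : Type u₂} [Bicategory.{w₂, v₂} B]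
variable {U : Pseudofunctor A B} {b : B}

/-- The trivial filler of a pseudosquare with equal sides and identity 2-cell. The 2-cell is only
required to be propositionally the identity, so that it may be given as a composite. -/
@[simps]
def Filler.refl {a a₂ : A} (n : b ⟶ U.obj a) {u : a ⟶ a₂} (α : n ≫ U.map u ≅ n ≫ U.map u)
    (hα : α.hom = 𝟙 _) : Filler U n α where
  w := 𝟙 a
  ν := whiskerLeftIso n (U.mapId a) ≪≫ ρ_ n
  ω := λ_ u
  paste := by simp [hα]

/-- The pasting of fillers of adjacent pseudosquares. -/
@[simps]
def Filler.trans {a a₁ a₂ a₃ : A} {n : b ⟶ U.obj a} {n' : b ⟶ U.obj a₁} {f : b ⟶ U.obj a₂}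
    {u : a ⟶ a₃} {u' : a₁ ⟶ a₃} {u'' : a₂ ⟶ a₃} {α : f ≫ U.map u'' ≅ n' ≫ U.map u'}
    {β : n' ≫ U.map u' ≅ n ≫ U.map u} (s : Filler U n' α) (t : Filler U n β) :
    Filler U n (α ≪≫ β) where
  w := t.w ≫ s.w
  ν := whiskerLeftIso n (U.mapComp t.w s.w) ≪≫ (α_ n (U.map t.w) (U.map s.w)).symm ≪≫
    whiskerRightIso t.ν (U.map s.w) ≪≫ s.ν
  ω := α_ t.w s.w u'' ≪≫ whiskerLeftIso t.w s.ω ≪≫ t.ω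
  paste := by
    have hs := s.paste
    have ht := t.paste
    simp only [Iso.trans_hom, whiskerLeftIso_hom, Iso.symm_hom, whiskerRightIso_hom,
      comp_whiskerRight, Category.assoc]
    rw [reassoc_of% hs, associator_naturality_left_assoc, ← whisker_exchange_assoc, ht]
    simp

theorem IsGeneric.of_existsUnique_cell {a : A} {n : b ⟶ U.obj a}
    (hfill : ∀ {a₁ a₂ : A} (f : b ⟶ U.obj a₁) (u : a₁ ⟶ a₂) (v : a ⟶ a₂)
      (α : f ≫ U.map u ≅ n ≫ U.map v), Nonempty (Filler U n α))
    (hcell : ∀ {a₁ a₂ : A} (f₁ f₂ : b ⟶ U.obj a₁) (u : a₁ ⟶ a₂) (v : a ⟶ a₂)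
      (α₁ : f₁ ≫ U.map u ≅ n ≫ U.map v) (α₂ : f₂ ≫ U.map u ≅ n ≫ U.map v) (φ : f₁ ⟶ f₂),
      φ ▷ U.map u ≫ α₂.hom = α₁.hom →
      ∀ (s : Filler U n α₁) (t : Filler U n α₂),
        ∃! σ : s.w ⟶ t.w, σ ▷ u ≫ t.ω.hom = s.ω.hom ∧
          n ◁ U.map₂ σ ≫ t.ν.hom = s.ν.hom ≫ φ) : IsGeneric U n where
  exists_filler := hfill
  exists_unique_cell := hcell
  filler_unique f u v α s t := by
    have cell (s t : Filler U n α) := hcell f f u v α α (𝟙 f) (by simp) s t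
    simp only [Category.comp_id] at cell
    obtain ⟨σ, ⟨hσ, hσ'⟩, σ_unique⟩ := cell s t
    obtain ⟨τ, ⟨hτ, hτ'⟩, -⟩ := cell t s
    have hστ : σ ≫ τ = 𝟙 s.w := (cell s s).unique (by simp [hσ, hσ', hτ, hτ']) (by simp)
    have hτσ : τ ≫ σ = 𝟙 t.w := (cell t t).unique (by simp [hσ, hσ', hτ, hτ']) (by simp)
    exact ⟨⟨σ, τ, hστ, hτσ⟩, ⟨hσ, hσ'⟩, fun ρ hρ => Iso.ext (σ_unique ρ.hom hρ)⟩

theorem IsGeneric.nonempty_iso {a a₁ a₂ : A} {n : b ⟶ U.obj a} (hn : IsGeneric U n)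
    {f : b ⟶ U.obj a₁} {u : a₁ ⟶ a₂} {v : a ⟶ a₂} {α : f ≫ U.map u ≅ n ≫ U.map v}
    (s t : Filler U n α) : Nonempty (s.w ≅ t.w) :=
  ⟨(hn.filler_unique _ _ _ _ s t).choose⟩

theorem IsGeneric.isEquiv_filler {a m m' : A} {n : b ⟶ U.obj m} {n' : b ⟶ U.obj m'}
    {u : m ⟶ a} {u' : m' ⟶ a} (hn : IsGeneric U n) (hn' : IsGeneric U n')
    {α : n ≫ U.map u ≅ n' ≫ U.map u'} (s : Filler U n' α) : IsEquiv s.w := by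
  obtain ⟨t⟩ := hn.exists_filler n' u' u α.symm
  exact ⟨t.w, hn'.nonempty_iso (t.trans s) (Filler.refl n' _ (by simp)),
    hn.nonempty_iso (s.trans t) (Filler.refl n _ (by simp))⟩

section Factorizations

variable {a m m' : A} {f : b ⟶ U.obj a} {n : b ⟶ U.obj m} {u : m ⟶ a} {n' : b ⟶ U.obj m'}
  {u' : m' ⟶ a} {α : n ≫ U.map u ≅ f} {β : n' ≫ U.map u' ≅ f}

/-- The filler underlying an equivalence of factorizations. -/
@[simps]
def GenericFactEquiv.toFiller (c : GenericFactEquiv U α β) : Filler U n' (α ≪≫ β.symm) where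
  w := c.e
  ν := c.ν
  ω := c.ω
  paste := by
    rw [← cancel_mono β.hom]
    simp [c.paste]

/-- The equivalence of factorizations given by a filler that is an equivalence. -/
def Filler.toGenericFactEquiv (s : Filler U n' (α ≪≫ β.symm)) (hs : IsEquiv s.w) :
    GenericFactEquiv U α β where
  e := s.w
  isEquiv := hs
  ν := s.ν
  ω := s.ω
  paste := by
    have h := s.paste
    rw [whiskerLeft_comp, ← Iso.inv_comp_eq] at h
    rw [← cancel_epi (n' ◁ (U.mapComp s.w u).inv), ← reassoc_of% h]
    simp

theorem IsGeneric.nonempty_genericFactEquiv (hn : IsGeneric U n) (hn' : IsGeneric U n')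
    (α : n ≫ U.map u ≅ f) (β : n' ≫ U.map u' ≅ f) : Nonempty (GenericFactEquiv U α β) := by
  obtain ⟨s⟩ := hn'.exists_filler n u u' (α ≪≫ β.symm)
  exact ⟨s.toGenericFactEquiv (hn.isEquiv_filler hn' s)⟩

end Factorizations

theorem IsBistable.of_exists_generic
    (h : ∀ {b : B} {a : A} (f : b ⟶ U.obj a), ∃ (m : A) (n : b ⟶ U.obj m) (u : m ⟶ a),
      Nonempty (n ≫ U.map u ≅ f) ∧ IsGeneric U n) : IsBistable U := by
  intro b a f
  obtain ⟨m, n, u, ⟨α⟩, hn⟩ := h f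
  exact ⟨m, n, u, α, hn, fun m' n' u' β hn' => ⟨hn.nonempty_genericFactEquiv hn' α β,
    fun c d => hn'.filler_unique _ _ _ _ c.toFiller d.toFiller⟩⟩

end Generic

section OpInclusion

open Bicategory.Opposite

variable {C : Type u} [Bicategory.{w, v} C] {S : SubData C}

/-- The invertible 2-cell underlying an invertible 2-cell of a sub-bicategory. -/
@[simps]
def Sub.isoCell {X Y : Sub S} {f g : X ⟶ Y} (e : f ≅ g) : Hom.hom f ≅ Hom.hom g where
  hom := e.hom.cell
  inv := e.inv.cell
  hom_inv_id := congrArg Hom₂.cell e.hom_inv_id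
  inv_hom_id := congrArg Hom₂.cell e.inv_hom_id

section Fillers

variable {b : C} {a : Sub S} {a₁ a₂ : (Sub S)ᵒᵖ} {n : a.obj ⟶ b}
  {f : op b ⟶ (opPseudofunctor (Sub.incl S)).obj a₁} {u : a₁ ⟶ a₂} {v : op a ⟶ a₂}
  {α : f ≫ (opPseudofunctor (Sub.incl S)).map u ≅ n.op ≫ (opPseudofunctor (Sub.incl S)).map v}

/-- The pseudosquare of `C` dual to a pseudosquare for the dual of the inclusion of `S`. -/
abbrev unopSquare
    (α : f ≫ (opPseudofunctor (Sub.incl S)).map u ≅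
      n.op ≫ (opPseudofunctor (Sub.incl S)).map v) :
    Sub.Hom.hom u.unop ≫ f.unop ≅ Sub.Hom.hom v.unop ≫ n :=
  α.unop2

/-- A filler for the dual of the inclusion of `S` is a diagonal in `C`. -/
def Filler.toLift (s : Filler (opPseudofunctor (Sub.incl S)) n.op α) : Lift (unopSquare α) where
  diag := Sub.Hom.hom s.w.unop
  left := Sub.isoCell s.ω.unop2
  right := s.ν.unop2
  w := by
    have h : Sub.Hom.hom u.unop ◁ s.ν.hom.unop2 ≫ α.hom.unop2 =
        (α_ (Sub.Hom.hom u.unop) (Sub.Hom.hom s.w.unop) n).inv ≫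
          (𝟙 _ ≫ s.ω.hom.unop2.cell) ▷ n := congrArg Hom2.unop2 s.paste
    rwa [Category.id_comp] at h

/-- A diagonal in `C` that is a 1-cell of `S` is a filler for the dual of the inclusion of `S`. -/
def Lift.toFiller (s : Lift (unopSquare α)) (hs : S.homProp s.diag) :
    Filler (opPseudofunctor (Sub.incl S)) n.op α :=
  let diag : a₁.unop ⟶ a := ⟨s.diag, hs⟩
  let left : u.unop ≫ diag ≅ v.unop := Sub.isoMk s.left
  { w := diag.op
    ν := s.right.op2
    ω := left.op2
    paste := by
      have h : Sub.Hom.hom u.unop ◁ s.right.hom ≫ (unopSquare α).hom =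
          (α_ (Sub.Hom.hom u.unop) s.diag n).inv ≫ (𝟙 _ ≫ s.left.hom) ▷ n := by
        rw [Category.id_comp, s.w]
      exact congrArg op2 h }

end Fillers

theorem IsGeneric.op_incl {b : C} {a : Sub S} {n : a.obj ⟶ b}
    (hn : ∀ {X Y : C} {u : X ⟶ Y}, S.homProp u → BiOrthogonal u n)
    (hcancel : HasRightCancellationAlong S.homProp S.homProp) :
    IsGeneric (opPseudofunctor (Sub.incl S)) (b := op b) (a := op a) n.op := by
  refine IsGeneric.of_existsUnique_cell ?_ ?_
  · intro a₁ a₂ f u v α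
    obtain ⟨s⟩ := (hn (Sub.Hom.property u.unop)).nonempty_lift (unopSquare α)
    exact ⟨s.toFiller
      (hcancel _ _ _ ⟨s.left⟩ (Sub.Hom.property v.unop) (Sub.Hom.property u.unop))⟩
  · intro a₁ a₂ f₁ f₂ u v α₁ α₂ φ hφ s t
    obtain ⟨σ, ⟨hσ, hσ'⟩, σ_unique⟩ := (hn (Sub.Hom.property u.unop)).existsUnique_lift_cell
      (congrArg Hom2.unop2 hφ) s.toLift t.toLift
    refine ⟨op2 ⟨σ⟩, ⟨congrArg op2 (Sub.hom₂_ext hσ), congrArg op2 hσ'⟩, fun τ ⟨hτ, hτ'⟩ => ?_⟩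
    exact congrArg op2 (Sub.hom₂_ext (σ_unique τ.unop2.cell
      ⟨congrArg (fun x => Sub.Hom₂.cell (Hom2.unop2 x)) hτ, congrArg Hom2.unop2 hτ'⟩))

theorem HasOrthogonalFactorizations.isBistable_op_incl {R : MorphismProperty C}
    (h : HasOrthogonalFactorizations S.homProp R)
    (hobj : ∀ ⦃a b : C⦄ (l : a ⟶ b), S.homProp l → S.objProp a → S.objProp b) :
    IsBistable (opPseudofunctor (Sub.incl S)) := by
  refine IsBistable.of_exists_generic fun {b a} f => ?_
  obtain ⟨M, l, r, hl, hr, ⟨α⟩⟩ := h.factorization f.unop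
  let m : Sub S := ⟨M, hobj l hl a.unop.property⟩
  let l' : a.unop ⟶ m := ⟨l, hl⟩
  exact ⟨op m, r.op, l'.op, ⟨α.op2⟩, IsGeneric.op_incl (a := m) (h.biOrthogonal · hr) h.cancel⟩

end OpInclusion

section Slice

variable {C : Type u} [Bicategory.{w, v} C] {X : C}

namespace PseudoSlice

/-- The invertible 2-cell underlying an invertible 2-cell of a pseudoslice. -/
@[simps]
def isoCell {a b : PseudoSlice X} {f g : a ⟶ b} (e : f ≅ g) : Hom.hom f ≅ Hom.hom g where
  hom := e.hom.cell
  inv := e.inv.cell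
  hom_inv_id := congrArg Hom₂.cell e.hom_inv_id
  inv_hom_id := congrArg Hom₂.cell e.inv_hom_id

/-- The 1-cell of the pseudoslice lifting `s` for which the 2-cell `r` becomes a 2-cell
`s ≫ g ≅ q` of the pseudoslice. -/
@[simps]
def homOfCompIso {b x d : PseudoSlice X} {g : x ⟶ d} {q : b ⟶ d} {s : b.dom ⟶ x.dom}
    (r : s ≫ Hom.hom g ≅ Hom.hom q) : b ⟶ x where
  hom := s
  iso := whiskerLeftIso s (Hom.iso g).symm ≪≫ (α_ s (Hom.hom g) d.str).symm ≪≫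
    whiskerRightIso r d.str ≪≫ Hom.iso q

/-- The invertible 2-cell of the pseudoslice exhibiting `homOfCompIso r` as a factorization of `q`
through `g`. -/
@[simps!]
def homOfCompIsoFac {b x d : PseudoSlice X} {g : x ⟶ d} {q : b ⟶ d} {s : b.dom ⟶ x.dom}
    (r : s ≫ Hom.hom g ≅ Hom.hom q) : homOfCompIso r ≫ g ≅ q :=
  isoMk r (by simp [homOfCompIso])

theorem whiskerRight_str_comp_iso {b x d : PseudoSlice X} {g : x ⟶ d} {s t : b ⟶ x}
    (ψ : s ≫ g ⟶ t ≫ g) {σ : Hom.hom s ⟶ Hom.hom t} (hσ : σ ▷ Hom.hom g = ψ.cell) :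
    σ ▷ x.str ≫ (Hom.iso t).hom = (Hom.iso s).hom := by
  have hψ := ψ.w
  rw [← hσ] at hψ
  rw [← cancel_epi (Hom.hom s ◁ (Hom.iso g).hom), whisker_exchange_assoc,
    ← cancel_epi (α_ _ _ _).hom]
  simpa using hψ

theorem biOrthogonal {a b x d : PseudoSlice X} {f : a ⟶ b} {g : x ⟶ d}
    (h : BiOrthogonal (Hom.hom f) (Hom.hom g)) : BiOrthogonal f g := by
  refine BiOrthogonal.mk ?_ ?_ ?_
  · intro p q e
    obtain ⟨s, l, r, hw⟩ := h.exists_filler (Hom.hom p) (Hom.hom q) (isoCell e)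
    let s' : b ⟶ x := homOfCompIso r
    let r' : s' ≫ g ≅ q := homOfCompIsoFac r
    have hl : l.hom ▷ Hom.hom g =
        (α_ (Hom.hom f) s (Hom.hom g)).hom ≫ Hom.hom f ◁ r.hom ≫ (isoCell e).inv := by
      rw [← Category.assoc, Iso.eq_comp_inv, hw]
    exact ⟨s', isoMk l (whiskerRight_str_comp_iso ((α_ f s' g).hom ≫ f ◁ r'.hom ≫ e.inv) hl), r',
      hom₂_ext hw⟩
  · intro s t φ ψ e
    obtain ⟨σ, hσ, hσ'⟩ := h.exists_cell φ.cell ψ.cell (congrArg Hom₂.cell e)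
    exact ⟨⟨σ, whiskerRight_str_comp_iso ψ hσ'⟩, hom₂_ext hσ, hom₂_ext hσ'⟩
  · intro s t σ τ hl hr
    exact hom₂_ext (h.cell_ext (congrArg Hom₂.cell hl) (congrArg Hom₂.cell hr))

end PseudoSlice

/-- The class of 1-cells of the pseudoslice whose underlying 1-cell is in `W`. -/
def overProp (W : MorphismProperty C) (X : C) : MorphismProperty (PseudoSlice X) :=
  fun _ _ f => W f.hom

theorem HasOrthogonalFactorizations.over {L R : MorphismProperty C}
    (h : HasOrthogonalFactorizations L R) (X : C) :
    HasOrthogonalFactorizations (overProp L X) (overProp R X) where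
  biOrthogonal hf hg := PseudoSlice.biOrthogonal (h.biOrthogonal hf hg)
  cancel _ _ _ _ _ _ := fun ⟨i⟩ => h.cancel _ _ _ ⟨PseudoSlice.isoCell i⟩
  factorization {a b} f := by
    obtain ⟨M, l, r, hl, hr, ⟨α⟩⟩ := h.factorization f.hom
    let m : PseudoSlice X := ⟨M, r ≫ b.str⟩
    let r' : m ⟶ b := ⟨r, Iso.refl _⟩
    exact ⟨m, PseudoSlice.homOfCompIso (g := r') α, r', hl, hr,
      ⟨PseudoSlice.homOfCompIsoFac (g := r') α⟩⟩

end Slice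

section LeftObjects

variable {C : Type u} [Bicategory.{w, v} C] {L R L' : MorphismProperty C}

theorem IsBiterminal.nonempty_hom {T : C} (hT : IsBiterminal T) (X : C) : Nonempty (X ⟶ T) := by
  obtain ⟨E⟩ := hT X
  exact ⟨E.inverse.obj ⟨⟨⟩⟩⟩

theorem IsBiterminal.nonempty_iso {T X : C} (hT : IsBiterminal T) (s t : X ⟶ T) :
    Nonempty (s ≅ t) := by
  obtain ⟨E⟩ := hT X
  exact ⟨E.functor.preimageIso (eqToIso (Subsingleton.elim _ _))⟩

theorem isBistable_op_incl_leftObj (hLR : IsBifactorizationSystem L R)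
    (hcancel : HasRightCancellationAlong L' L) {T : C} (hT : IsBiterminal T) :
    IsBistable (opPseudofunctor (Sub.incl (leftObj hLR L' T))) := by
  refine HasOrthogonalFactorizations.isBistable_op_incl (S := leftObj hLR L' T)
    hLR.hasOrthogonalFactorizations ?_
  rintro a b l hl ⟨t, ht⟩
  obtain ⟨t'⟩ := hT.nonempty_hom b
  exact ⟨t', hcancel l t' t (hT.nonempty_iso _ _) ht hl⟩

theorem isBistable_op_incl_leftObjOver (hLR : IsBifactorizationSystem L R)
    (hcancel : HasRightCancellationAlong L' L) (X : C) :
    IsBistable (opPseudofunctor (Sub.incl (leftObjOver hLR L' X))) :=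
  HasOrthogonalFactorizations.isBistable_op_incl (S := leftObjOver hLR L' X)
    (hLR.hasOrthogonalFactorizations.over X)
    fun a b l hl ha => hcancel l.hom b.str a.str ⟨l.iso⟩ ha hl

end LeftObjects

end BiStab

theorem mainTheorem4_general {C : Type u} [Bicategory.{w, v} C] {L R : MorphismProperty C}
    (hLR : BiStab.IsBifactorizationSystem L R) {L' : MorphismProperty C}
    (hcancel : BiStab.HasRightCancellationAlong L' L) :
    (∀ T : C, BiStab.IsBiterminal T →
      BiStab.IsBistable
        (BiStab.opPseudofunctor (BiStab.Sub.incl (BiStab.leftObj hLR L' T)))) ∧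
    (∀ X : C,
      BiStab.IsBistable
        (BiStab.opPseudofunctor (BiStab.Sub.incl (BiStab.leftObjOver hLR L' X)))) :=
  ⟨fun _ hT => BiStab.isBistable_op_incl_leftObj hLR hcancel hT,
    BiStab.isBistable_op_incl_leftObjOver hLR hcancel⟩

theorem mainTheorem4 {C : Type u} [Bicategory.{w, v} C] (L R : MorphismProperty C)
    (hLR : BiStab.IsBifactorizationSystem L R) (L' : MorphismProperty C) (hL' : L' ≤ L)
    (hcancel : BiStab.HasRightCancellationAlong L' L) :
    (∀ T : C, BiStab.IsBiterminal T → (∀ X : C, L' (𝟙 X)) →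
      BiStab.IsBistable
        (BiStab.opPseudofunctor (BiStab.Sub.incl (BiStab.leftObj hLR L' T)))) ∧
    (∀ X : C,
      BiStab.IsBistable
        (BiStab.opPseudofunctor (BiStab.Sub.incl (BiStab.leftObjOver hLR L' X)))) :=
  ⟨fun T hT _ => (mainTheorem4_general hLR hcancel).1 T hT, (mainTheorem4_general hLR hcancel).2⟩
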